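/- For a complex square matrix $M$ let $\|M\|_2=\sqrt{\operatorname{Tr}(M^*M)}$ be its Frobenius norm, where $\operatorname{Tr}$ is the unnormalized trace, and let $U(N)$ be the group of $N\times N$ unitary matrices. A countable discrete group $\Gamma$ is called \emph{Frobenius stable} if, for every sequence of integers $N_n\ge 1$ and every sequence of functions $\rho_n:\Gamma\to U(N_n)$ with $\|\rho_n(xy)-\rho_n(x)\rho_n(y)\|_2\to 0$ as $n\to\infty$ for all $x,y\in\Gamma$, there is a sequence of group homomorphisms $\tilde\rho_n:\Gamma\to U(N_n)$ with $\|\tilde\rho_n(x)-\rho_n(x)\|_2\to 0$ as $n\to\infty$ for all $x\in\Gamma$. Theorem. Let $\Gamma$ be a torsion-free, finitely generated nilpotent group that is neither trivial nor isomorphic to $\mathbb{Z}$. Then $\Gamma$ is not Frobenius stable. That is, there are integers $N_n\ge1$ and functions $\rho_n:\Gamma\to U(N_n)$ such that $\|\rho_n(xy)-\rho_n(x)\rho_n(y)\|_2\to 0$ for all $x,y\in\Gamma$, but for no sequence of group homomorphisms $\tilde\rho_n:\Gamma\to U(N_n)$ does $\|\tilde\rho_n(x)-\rho_n(x)\|_2\to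 0$ hold for all $x\in\Gamma$. -/

import Mathlib

open Filter Topology

/-- The Frobenius norm `‖M‖₂ = √(Tr (M* M))`, with the unnormalized trace. -/
noncomputable def frobeniusNorm {N : ℕ} (M : Matrix (Fin N) (Fin N) ℂ) : ℝ :=
  Real.sqrt (Matrix.trace (M.conjTranspose * M)).re

/-- A sequence of functions `ρ n : Γ → U(N n)` is a Frobenius asymptotic homomorphism if
`‖ρ n (x y) - ρ n x * ρ n y‖₂ → 0` for all `x, y`. -/
def IsFrobeniusAsymptoticHom {Γ : Type*} [Group Γ] (N : ℕ → ℕ)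
    (ρ : ∀ n : ℕ, Γ → Matrix.unitaryGroup (Fin (N n)) ℂ) : Prop :=
  ∀ x y : Γ, Tendsto
    (fun n : ℕ => frobeniusNorm
      ((ρ n (x * y) : Matrix (Fin (N n)) (Fin (N n)) ℂ) -
        (ρ n x : Matrix (Fin (N n)) (Fin (N n)) ℂ) * (ρ n y : Matrix (Fin (N n)) (Fin (N n)) ℂ)))
    atTop (𝓝 0)

/-- A sequence `ρ n : Γ → U(N n)` is perturbable in the Frobenius norm to a sequence of genuine
representations if there are homomorphisms `π n : Γ → U(N n)`, into the same unitary groups, with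
`‖π n x - ρ n x‖₂ → 0` for all `x`. -/
def IsFrobeniusPerturbable {Γ : Type*} [Group Γ] (N : ℕ → ℕ)
    (ρ : ∀ n : ℕ, Γ → Matrix.unitaryGroup (Fin (N n)) ℂ) : Prop :=
  ∃ π : ∀ n : ℕ, Γ →* Matrix.unitaryGroup (Fin (N n)) ℂ,
    ∀ x : Γ, Tendsto
      (fun n : ℕ => frobeniusNorm
        ((π n x : Matrix (Fin (N n)) (Fin (N n)) ℂ) - (ρ n x : Matrix (Fin (N n)) (Fin (N n)) ℂ)))
      atTop (𝓝 0)

/-- `Γ` is Frobenius stable if every Frobenius asymptotic homomorphism, in positive dimensions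
`N n`, is perturbable in the Frobenius norm to a sequence of genuine representations. -/
def FrobeniusStable (Γ : Type*) [Group Γ] : Prop :=
  ∀ (N : ℕ → ℕ) (_ : ∀ n, 0 < N n) (ρ : ∀ n : ℕ, Γ → Matrix.unitaryGroup (Fin (N n)) ℂ),
    IsFrobeniusAsymptoticHom N ρ → IsFrobeniusPerturbable N ρ

/-!
The group `Γ` maps onto `ℤ` with an infinite, finitely generated kernel `K`, on which conjugation
by a lift `t` of `1` is a unipotent automorphism `φ`. Hence some `k ∈ K` has infinite order in the
abelianization of `K` although `φ k * k⁻¹` has finite order there, and some integral character `χ`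
of `K` does not vanish at `k`.

For a large prime `N`, let `K` act on `ℂ ^ N` by the diagonal characters `e ^ (2 π i hⱼ / N)`, where
`hⱼ = χ + χ ∘ φ + ⋯ + χ ∘ φ ^ (j - 1)`. Unipotency makes `h_N` divisible by `N`, so conjugation by
the cyclic shift implements `φ` up to the scalars `e ^ (2 π i χ / N)`. Their Frobenius distance to
the identity is of order `N ^ (-1/2)`, so this is an asymptotic homomorphism of `Γ`.

On unitary matrices close to the identity in the Frobenius norm, `log det` is additive and invariant
under conjugation, because it differs from the trace of `u - 1` by at most `‖u - 1‖₂ ^ 2`. If the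
asymptotic homomorphism were close to true representations, the `log det` of the quotient of the
two would therefore be a homomorphism from `K` to an abelian group whose value at `φ k * k⁻¹` is
`-2 π i χ(k)`, the negative of the `log det` of the scalar. This value would be torsion, hence
`χ(k) = 0`.
-/

section IntegralCharacters

theorem exists_ne_one_of_not_isOfFinOrder {A : Type*} [CommGroup A] [Group.FG A] {a : A}
    (ha : ¬ IsOfFinOrder a) : ∃ χ : A →* Multiplicative ℤ, χ a ≠ 1 := by
  have : Module.Finite ℤ (Additive A) := Module.Finite.iff_addGroup_fg.mpr inferInstance
  set q := (Submodule.torsion ℤ (Additive A)).mkQ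
  have hqa : q (Additive.ofMul a) ≠ 0 := fun h => by
    rw [Submodule.mkQ_apply, Submodule.Quotient.mk_eq_zero, Submodule.mem_torsion_iff] at h
    obtain ⟨⟨n, hn⟩, hna⟩ := h
    exact ha (isOfFinOrder_iff_zpow_eq_one.mpr ⟨n, nonZeroDivisors.ne_zero hn, hna⟩)
  obtain ⟨f, hf⟩ := Module.Projective.exists_dual_ne_zero ℤ hqa
  exact ⟨AddMonoidHom.toMultiplicativeRight (f ∘ₗ q).toAddMonoidHom, hf⟩

theorem exists_ne_one_of_not_isOfFinOrder_abelianization {G : Type*} [Group G]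
    [Group.FG (Abelianization G)] {x : G} (hx : ¬ IsOfFinOrder (Abelianization.of x)) :
    ∃ χ : G →* Multiplicative ℤ, χ x ≠ 1 := by
  obtain ⟨χ, hχ⟩ := exists_ne_one_of_not_isOfFinOrder hx
  exact ⟨χ.comp Abelianization.of, hχ⟩

theorem exists_eq_ofAdd_one_of_ne_one {G : Type*} [Group G] {χ : G →* Multiplicative ℤ} {x : G}
    (hx : χ x ≠ 1) : ∃ (τ : G →* Multiplicative ℤ) (t : G), τ t = Multiplicative.ofAdd 1 := by
  have : Infinite χ.range := Infinite.of_injective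
    (fun n : ℕ => (⟨χ x ^ n, x ^ n, map_pow χ x n⟩ : χ.range)) fun m n h =>
      injective_pow_iff_not_isOfFinOrder.mpr (not_isOfFinOrder_of_isMulTorsionFree hx)
        (congrArg Subtype.val h)
  obtain ⟨t, ht⟩ := χ.rangeRestrict_surjective (intCyclicMulEquiv (Multiplicative.ofAdd 1))
  exact ⟨intCyclicMulEquiv.symm.toMonoidHom.comp χ.rangeRestrict, t,
    intCyclicMulEquiv.symm_apply_eq.mpr ht⟩

end IntegralCharacters

section Nilpotent

open scoped commutatorElement

instance {G : Type*} [Group G] [Group.FG G] : Group.FG (Abelianization G) := QuotientGroup.fg _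

theorem commutatorElement_mul_of_mem_center {G : Type*} [Group G] {z : G}
    (hz : z ∈ Subgroup.center G) (x y : G) : ⁅x * z, y⁆ = ⁅x, y⁆ := by
  have hzy : z * y * z⁻¹ = y := by rw [← Subgroup.mem_center_iff.mp hz, mul_inv_cancel_right]
  calc ⁅x * z, y⁆ = x * (z * y * z⁻¹) * x⁻¹ * y⁻¹ := by rw [commutatorElement_def]; group
    _ = ⁅x, y⁆ := by rw [hzy, commutatorElement_def]

theorem finite_commutator_of_finiteIndex_center {G : Type*} [Group G]
    [(Subgroup.center G).FiniteIndex] : Finite (commutator G) := by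
  suffices (commutatorSet G).Finite by
    have := this.to_subtype
    infer_instance
  refine (Set.finite_range fun p : (G ⧸ Subgroup.center G) × (G ⧸ Subgroup.center G) =>
    ⁅p.1.out, p.2.out⁆).subset ?_
  rintro _ ⟨x, y, rfl⟩
  obtain ⟨z, hz⟩ := QuotientGroup.mk_out_eq_mul (Subgroup.center G) x
  obtain ⟨w, hw⟩ := QuotientGroup.mk_out_eq_mul (Subgroup.center G) y
  refine ⟨(x, y), ?_⟩
  simp only [hz, hw, commutatorElement_mul_of_mem_center z.2]
  rw [← commutatorElement_inv, commutatorElement_mul_of_mem_center w.2, commutatorElement_inv]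

theorem abelianizationMap_surjective {G H : Type*} [Group G] [Group H] {f : G →* H}
    (hf : Function.Surjective f) : Function.Surjective (Abelianization.map f) := by
  intro y
  obtain ⟨y, rfl⟩ := QuotientGroup.mk_surjective y
  obtain ⟨x, rfl⟩ := hf y
  exact ⟨Abelianization.of x, Abelianization.map_of f x⟩

theorem finite_of_finite_abelianization {G : Type*} [Group G] [Group.IsNilpotent G]
    [Finite (Abelianization G)] : Finite G := by
  suffices Finite (Abelianization G) → Finite G from this inferInstance
  refine Group.nilpotent_center_quotient_ind
    (P := fun G _ _ => Finite (Abelianization G) → Finite G) G ?_ ?_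
  · intro G _ _ _
    infer_instance
  · intro G _ _ ih hG
    have : Finite (Abelianization (G ⧸ Subgroup.center G)) :=
      Finite.of_surjective (Abelianization.map (QuotientGroup.mk' (Subgroup.center G)))
        (abelianizationMap_surjective (QuotientGroup.mk'_surjective _))
    have := ih this
    have : (Subgroup.center G).FiniteIndex := Subgroup.finiteIndex_of_finite_quotient
    have := finite_commutator_of_finiteIndex_center (G := G)
    have : Finite (G ⧸ commutator G) := hG
    exact Finite.of_subgroup_quotient (commutator G)

theorem exists_not_isOfFinOrder_abelianization (G : Type*) [Group G] [Group.IsNilpotent G]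
    [Infinite G] [Group.FG (Abelianization G)] : ∃ x : G, ¬ IsOfFinOrder (Abelianization.of x) := by
  by_contra! h
  have := CommGroup.finite_of_fg_isMulTorsion (G := Abelianization G)
    (QuotientGroup.mk_surjective.forall.mpr h)
  have := finite_of_finite_abelianization (G := G)
  exact not_finite G

theorem exists_eq_ofAdd_one_of_infinite_of_isNilpotent (G : Type*) [Group G]
    [Group.IsNilpotent G] [Infinite G] [Group.FG (Abelianization G)] :
    ∃ (τ : G →* Multiplicative ℤ) (t : G), τ t = Multiplicative.ofAdd 1 := by
  obtain ⟨x, hx⟩ := exists_not_isOfFinOrder_abelianization G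
  obtain ⟨χ, hχ⟩ := exists_ne_one_of_not_isOfFinOrder_abelianization hx
  exact exists_eq_ofAdd_one_of_ne_one hχ

end Nilpotent

section UnipotentAutomorphisms

variable {K : Type*} [Group K] {φ : MulAut K}

/-- The multiplicative form `k ↦ φ k * k⁻¹` of `φ - 1`. -/
def displacement (φ : MulAut K) (k : K) : K := φ k * k⁻¹

/-- An automorphism is unipotent if a fixed iterate of its displacement map is trivial. -/
def IsUnipotent (φ : MulAut K) : Prop := ∃ d, ∀ k, (displacement φ)^[d] k = 1

theorem displacement_one (φ : MulAut K) : displacement φ 1 = 1 := by simp [displacement]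

theorem map_iterate_displacement (φ : MulAut K) (j : ℕ) (k : K) :
    φ ((displacement φ)^[j] k) = (displacement φ)^[j + 1] k * (displacement φ)^[j] k := by
  rw [Function.iterate_succ_apply', displacement, inv_mul_cancel_right]

theorem iterate_displacement_eq_one_of_le {d j : ℕ} (hd : ∀ k, (displacement φ)^[d] k = 1)
    (hdj : d ≤ j) (k : K) : (displacement φ)^[j] k = 1 := by
  rw [← Nat.sub_add_cancel hdj, Function.iterate_add_apply, hd,
    Function.iterate_fixed (displacement_one φ)]

theorem IsUnipotent.exists_fg_map_eq (hφ : IsUnipotent φ) {S : Set K} (hS : S.Finite) :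
    ∃ H : Subgroup K, H.FG ∧ S ⊆ H ∧ H.map φ.toMonoidHom = H := by
  obtain ⟨d, hd⟩ := hφ
  set H := Subgroup.closure (Set.image2 (fun j s => (displacement φ)^[j] s) (Set.Iic d) S) with hH
  have iterate_mem : ∀ j, ∀ s ∈ S, (displacement φ)^[j] s ∈ H := fun j s hs => by
    rcases le_total j d with hj | hj
    · exact Subgroup.subset_closure ⟨j, hj, s, hs, rfl⟩
    · rw [iterate_displacement_eq_one_of_le hd hj]
      exact one_mem H
  refine ⟨H, (Subgroup.fg_iff _).mpr ⟨_, hH.symm, (Set.finite_Iic d).image2 _ hS⟩,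
    fun s hs => iterate_mem 0 s hs, le_antisymm ?_ ?_⟩
  · rw [Subgroup.map_le_iff_le_comap, hH, Subgroup.closure_le]
    rintro _ ⟨j, -, s, hs, rfl⟩
    change φ _ ∈ H
    rw [map_iterate_displacement]
    exact mul_mem (iterate_mem _ s hs) (iterate_mem _ s hs)
  · rw [hH, Subgroup.closure_le, ← hH]
    rintro _ ⟨j, hj, s, hs, rfl⟩
    refine Nat.decreasingInduction (n := d) (motive := fun j _ => (displacement φ)^[j] s ∈ _)
      (fun j _ ih => ?_) ?_ hj
    · have h := mul_mem (inv_mem ih) (Subgroup.mem_map_of_mem φ.toMonoidHom (iterate_mem j s hs))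
      change _ * φ _ ∈ _ at h
      rwa [map_iterate_displacement, inv_mul_cancel_left] at h
    · rw [hd]
      exact one_mem _

end UnipotentAutomorphisms

section SplittingOverInt

variable {Γ : Type*} [Group Γ] {τ : Γ →* Multiplicative ℤ} {t : Γ}

theorem iterate_displacement_conjNormal_mem_lowerCentralSeries (H : Subgroup Γ) [H.Normal] (t : Γ)
    (j : ℕ) (k : H) : (((displacement (MulAut.conjNormal t))^[j] k : H) : Γ) ∈
      (⊤ : Subgroup Γ).lowerCentralSeries j := by
  induction j with
  | zero => trivial
  | succ j ih =>
    rw [Function.iterate_succ_apply', displacement, Subgroup.coe_mul, MulAut.conjNormal_apply,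
      Subgroup.lowerCentralSeries_succ, Subgroup.commutator_comm]
    exact Subgroup.commutator_mem_commutator (Subgroup.mem_top t) ih

theorem isUnipotent_conjNormal [Group.IsNilpotent Γ] (H : Subgroup Γ) [H.Normal] (t : Γ) :
    IsUnipotent (MulAut.conjNormal t : MulAut H) := by
  obtain ⟨d, hd⟩ := Subgroup.nilpotent_iff_lowerCentralSeries.mp ‹Group.IsNilpotent Γ›
  refine ⟨d, fun k => Subtype.ext ?_⟩
  have h := iterate_displacement_conjNormal_mem_lowerCentralSeries H t d k
  rwa [hd, Subgroup.mem_bot] at h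

theorem map_zpow_of_eq_ofAdd_one (ht : τ t = Multiplicative.ofAdd 1) (a : ℤ) :
    τ (t ^ a) = Multiplicative.ofAdd a := by
  rw [map_zpow, ht, ← ofAdd_zsmul, smul_eq_mul, mul_one]

theorem surjective_of_eq_ofAdd_one (ht : τ t = Multiplicative.ofAdd 1) : Function.Surjective τ :=
  fun a => ⟨t ^ a.toAdd, map_zpow_of_eq_ofAdd_one ht _⟩

/-- The component of `x` in the kernel of `τ`, for the splitting of `τ` that sends `1` to `t`. -/
def kerPart (ht : τ t = Multiplicative.ofAdd 1) (x : Γ) : τ.ker :=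
  ⟨x * (t ^ (τ x).toAdd)⁻¹, by
    rw [MonoidHom.mem_ker, map_mul, map_inv, map_zpow_of_eq_ofAdd_one ht, ofAdd_toAdd,
      mul_inv_cancel]⟩

theorem kerPart_mul_zpow (ht : τ t = Multiplicative.ofAdd 1) (x : Γ) :
    kerPart ht x * t ^ (τ x).toAdd = x :=
  inv_mul_cancel_right _ _

theorem kerPart_coe (ht : τ t = Multiplicative.ofAdd 1) (k : τ.ker) : kerPart ht k = k :=
  Subtype.ext (by simp [kerPart, MonoidHom.mem_ker.mp k.2])

theorem kerPart_self (ht : τ t = Multiplicative.ofAdd 1) : kerPart ht t = 1 :=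
  Subtype.ext (by simp [kerPart, ht])

theorem kerPart_mul (ht : τ t = Multiplicative.ofAdd 1) (x y : Γ) : kerPart ht (x * y) =
    kerPart ht x * ((MulAut.conjNormal t : MulAut τ.ker) ^ (τ x).toAdd) (kerPart ht y) := by
  apply Subtype.ext
  rw [← map_zpow, Subgroup.coe_mul, MulAut.conjNormal_apply]
  simp only [kerPart, map_mul, toAdd_mul]
  group

theorem finiteIndex_zpowers_of_finite_ker (ht : τ t = Multiplicative.ofAdd 1) [Finite τ.ker] :
    (Subgroup.zpowers t).FiniteIndex := by
  have : Finite (Γ ⧸ Subgroup.zpowers t) :=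
    Finite.of_surjective (fun k : τ.ker => ((k : Γ) : Γ ⧸ Subgroup.zpowers t)) fun q => by
      obtain ⟨x, rfl⟩ := QuotientGroup.mk_surjective q
      exact ⟨kerPart ht x, QuotientGroup.eq.mpr
        ⟨(τ x).toAdd, eq_inv_mul_of_mul_eq (kerPart_mul_zpow ht x)⟩⟩
  exact Subgroup.finiteIndex_of_finite_quotient

theorem fg_ker_of_isUnipotent [Group.FG Γ] (ht : τ t = Multiplicative.ofAdd 1)
    (hφ : IsUnipotent (MulAut.conjNormal t : MulAut τ.ker)) : Group.FG τ.ker := by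
  obtain ⟨S, hS, hSfin⟩ := Group.fg_iff.mp ‹Group.FG Γ›
  obtain ⟨H, hHfg, hSH, hHφ⟩ := hφ.exists_fg_map_eq (hSfin.image (kerPart ht))
  set M := H.map τ.ker.subtype with hM
  have ht_mem : t ∈ Subgroup.normalizer (M : Set Γ) := by
    rw [Subgroup.mem_normalizer_iff_map_conj_eq, hM, Subgroup.map_map]
    conv_rhs => rw [← hHφ, Subgroup.map_map]
    rfl
  have hsup : M ⊔ Subgroup.zpowers t = ⊤ := by
    rw [eq_top_iff, ← hS, Subgroup.closure_le]
    intro s hs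
    rw [← kerPart_mul_zpow ht s]
    exact Subgroup.mul_mem_sup ⟨_, hSH ⟨s, hs, rfl⟩, rfl⟩ ⟨_, rfl⟩
  have hnormal : M.Normal := by
    rw [← Subgroup.normalizer_eq_top_iff, eq_top_iff, ← hsup]
    exact sup_le Subgroup.le_normalizer (Subgroup.zpowers_le.mpr ht_mem)
  suffices H = ⊤ from ⟨this ▸ hHfg⟩
  refine eq_top_iff.mpr fun k _ => ?_
  obtain ⟨_, ⟨h, hh, rfl⟩, _, ⟨a, rfl⟩, hk⟩ :=
    Subgroup.mem_sup_of_normal_left.mp (hsup ▸ Subgroup.mem_top (k : Γ))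
  have ha : a = 0 := by
    have hτ := congrArg τ hk
    rwa [map_mul, map_zpow_of_eq_ofAdd_one ht, MonoidHom.mem_ker.mp k.2, Subgroup.subtype_apply,
      MonoidHom.mem_ker.mp h.2, one_mul, ofAdd_eq_one] at hτ
  have hkh : k = h := Subtype.ext (by simpa [ha] using hk.symm)
  exact hkh ▸ hh

theorem injective_of_finiteIndex_isCyclic {B : Type*} [Group B] [IsMulTorsionFree B] {f : Γ →* B}
    (htf : ∀ x : Γ, x ≠ 1 → ¬ IsOfFinOrder x) (hf : f ≠ 1) (H : Subgroup Γ) [H.FiniteIndex]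
    [IsCyclic H] : Function.Injective f := by
  obtain ⟨h, hH⟩ := (Subgroup.isCyclic_iff_exists_zpowers_eq_top H).mp inferInstance
  have exists_pow_eq : ∀ x : Γ, ∃ m > 0, ∃ a : ℤ, h ^ a = x ^ m := fun x => by
    obtain ⟨m, hm, -, hx⟩ := Subgroup.exists_pow_mem_of_index_ne_zero H.index_ne_zero_of_finite x
    exact ⟨m, hm, Subgroup.mem_zpowers_iff.mp (hH ▸ hx)⟩
  have hfh : f h ≠ 1 := fun hfh => hf <| MonoidHom.ext fun x => by
    obtain ⟨m, hm, a, ha⟩ := exists_pow_eq x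
    have hfx := congrArg f ha
    rw [map_zpow, hfh, one_zpow, map_pow] at hfx
    exact (pow_eq_one_iff_left hm.ne').mp hfx.symm
  refine (injective_iff_map_eq_one f).mpr fun x hx => ?_
  obtain ⟨m, hm, a, ha⟩ := exists_pow_eq x
  have hfa := congrArg f ha
  rw [map_zpow, map_pow, hx, one_pow] at hfa
  have ha0 : a = 0 := (IsMulTorsionFree.zpow_eq_one_iff_right hfh).mp hfa
  by_contra hne
  exact htf x hne (isOfFinOrder_iff_pow_eq_one.mpr ⟨m, hm, by rw [← ha, ha0, zpow_zero]⟩)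

end SplittingOverInt

section OrbitSums

variable {K : Type*} [Group K] {φ : MulAut K}

theorem IsUnipotent.exists_isOfFinOrder_displacement (hφ : IsUnipotent φ) {x : K}
    (hx : ¬ IsOfFinOrder (Abelianization.of x)) :
    ∃ k : K, ¬ IsOfFinOrder (Abelianization.of k) ∧
      IsOfFinOrder (Abelianization.of (displacement φ k)) := by
  obtain ⟨d, hd⟩ := hφ
  by_contra! h
  have iterate_infinite_order : ∀ j,
      ¬ IsOfFinOrder (Abelianization.of ((displacement φ)^[j] x)) := by
    intro j
    induction j with
    | zero => exact hx
    | succ j ih =>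
      rw [Function.iterate_succ_apply']
      exact h _ ih
  exact iterate_infinite_order d (by rw [hd, map_one]; exact .one)

/-- The sum `χ + χ ∘ φ + ⋯ + χ ∘ φ ^ (m - 1)` of an integral character along an orbit of `φ`. -/
def orbitSum (φ : MulAut K) (χ : K →* Multiplicative ℤ) (m : ℕ) : K →* Multiplicative ℤ :=
  ∏ l ∈ Finset.range m, χ.comp (φ ^ l : MulAut K).toMonoidHom

theorem orbitSum_zero (φ : MulAut K) (χ : K →* Multiplicative ℤ) : orbitSum φ χ 0 = 1 := rfl

theorem toAdd_orbitSum_apply (φ : MulAut K) (χ : K →* Multiplicative ℤ) (m : ℕ) (k : K) :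
    (orbitSum φ χ m k).toAdd = ∑ l ∈ Finset.range m, (χ ((φ ^ l) k)).toAdd := by
  simp [orbitSum]

theorem orbitSum_succ_apply (φ : MulAut K) (χ : K →* Multiplicative ℤ) (m : ℕ) (k : K) :
    orbitSum φ χ (m + 1) k = χ k * orbitSum φ χ m (φ k) := by
  rw [orbitSum, Finset.prod_range_succ', orbitSum, MonoidHom.mul_apply, MonoidHom.finsetProd_apply,
    MonoidHom.finsetProd_apply, mul_comm]
  rfl

theorem fwdDiff_iter_toAdd_apply (φ : MulAut K) (χ : K →* Multiplicative ℤ) (j : ℕ) (k : K) :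
    (fwdDiff 1)^[j] (fun l : ℕ => (χ ((φ ^ l) k)).toAdd) =
      fun l : ℕ => (χ ((φ ^ l) ((displacement φ)^[j] k))).toAdd := by
  induction j generalizing k with
  | zero => rfl
  | succ j ih =>
    rw [Function.iterate_succ_apply, Function.iterate_succ_apply, ← ih]
    congr 1
    funext l
    rw [fwdDiff, displacement, map_mul, map_mul, map_inv, map_inv, toAdd_mul, toAdd_inv, pow_succ,
      MulAut.mul_apply, sub_eq_add_neg]

theorem toAdd_orbitSum_eq_sum_choose (φ : MulAut K) (χ : K →* Multiplicative ℤ) (m : ℕ) (k : K) :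
    (orbitSum φ χ m k).toAdd =
      ∑ j ∈ Finset.range m, (m.choose (j + 1) : ℤ) * (χ ((displacement φ)^[j] k)).toAdd := by
  have hΔ : fwdDiff 1 (fun l : ℕ => (orbitSum φ χ l k).toAdd) =
      fun l : ℕ => (χ ((φ ^ l) k)).toAdd := by
    funext l
    simp [fwdDiff, toAdd_orbitSum_apply, Finset.sum_range_succ]
  have h := shift_eq_sum_fwdDiff_iter (1 : ℕ) (fun l : ℕ => (orbitSum φ χ l k).toAdd) m 0
  rw [nsmul_one, zero_add, Nat.cast_id, Finset.sum_range_succ'] at h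
  simpa [Function.iterate_succ_apply, hΔ, fwdDiff_iter_toAdd_apply, orbitSum_zero] using h

theorem IsUnipotent.exists_forall_prime_dvd_orbitSum (hφ : IsUnipotent φ)
    (χ : K →* Multiplicative ℤ) :
    ∃ d : ℕ, ∀ p : ℕ, p.Prime → d ≤ p → ∀ k, (p : ℤ) ∣ (orbitSum φ χ p k).toAdd := by
  obtain ⟨d, hd⟩ := hφ
  refine ⟨d + 1, fun p hp hdp k => ?_⟩
  rw [toAdd_orbitSum_eq_sum_choose]
  refine Finset.dvd_sum fun j hj => ?_
  rcases (Nat.succ_le_of_lt (Finset.mem_range.mp hj)).lt_or_eq with hjp | hjp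
  · exact Dvd.dvd.mul_right (Int.natCast_dvd_natCast.mpr
      (hp.dvd_choose_self j.succ_ne_zero hjp)) _
  · rw [iterate_displacement_eq_one_of_le hd (by omega)]
    simp

end OrbitSums

section NullFamilies

theorem dist_mul_one_le {G : Type*} [Group G] [PseudoMetricSpace G] [IsIsometricSMul G G]
    (u v : G) : dist (u * v) 1 ≤ dist u 1 + dist v 1 :=
  calc dist (u * v) 1 ≤ dist (u * v) (u * 1) + dist (u * 1) 1 := dist_triangle _ _ _
    _ = dist u 1 + dist v 1 := by rw [dist_mul_left, mul_one, add_comm]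

variable {ι : Type*} {U : ι → Type*} [∀ i, Group (U i)] [∀ i, PseudoMetricSpace (U i)]
  [∀ i, IsIsometricSMul (U i) (U i)] [∀ i, IsIsometricSMul (U i)ᵐᵒᵖ (U i)] {l : Filter ι}
  {X Y : ∀ i, U i}

variable (U l) in
/-- The families in a product of groups with bi-invariant metrics whose distance to the identity
tends to zero along `l`. -/
def nullFamilies : Subgroup (∀ i, U i) where
  carrier := {X | Tendsto (fun i => dist (X i) 1) l (𝓝 0)}
  one_mem' := by simpa using tendsto_const_nhds
  mul_mem' {X Y} hX hY := by
    refine squeeze_zero (fun _ => dist_nonneg) (fun i => ?_) (add_zero (0 : ℝ) ▸ hX.add hY)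
    exact dist_mul_one_le (X i) (Y i)
  inv_mem' {X} hX := hX.congr fun i => by
    rw [Pi.inv_apply, ← dist_inv_inv, inv_one]

theorem mk_eq_mk_iff_tendsto_dist : (X : (∀ i, U i) ⧸ nullFamilies U l) = Y ↔
    Tendsto (fun i => dist (Y i) (X i)) l (𝓝 0) := by
  refine QuotientGroup.eq.trans (tendsto_congr fun i => ?_)
  rw [← dist_mul_left (X i), Pi.mul_apply, Pi.inv_apply, mul_inv_cancel_left, mul_one]

instance : (nullFamilies U l).Normal where
  conj_mem X hX V := hX.congr fun i => by
    rw [Pi.mul_apply, Pi.mul_apply, Pi.inv_apply, ← dist_mul_right (_ * _) 1 (V i),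
      inv_mul_cancel_right, one_mul, ← dist_mul_left (V i) (X i) 1, mul_one]

end NullFamilies

section FrobeniusMetric

open scoped Matrix.Norms.Frobenius Matrix

variable {n : Type*} [Fintype n]

theorem frobenius_norm_sq_eq_sum (A : Matrix n n ℂ) : ‖A‖ ^ 2 = ∑ i, ∑ j, ‖A i j‖ ^ 2 := by
  rw [Matrix.frobenius_norm_def, ← Real.sqrt_eq_rpow, Real.sq_sqrt (by positivity)]
  simp only [Real.rpow_ofNat]

theorem frobenius_norm_eq_sqrt_sum (A : Matrix n n ℂ) : ‖A‖ = √(∑ i, ∑ j, ‖A i j‖ ^ 2) := by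
  rw [← frobenius_norm_sq_eq_sum, Real.sqrt_sq (norm_nonneg A)]

theorem frobenius_norm_eq_sqrt_trace (A : Matrix n n ℂ) : ‖A‖ = √(Aᴴ * A).trace.re := by
  rw [frobenius_norm_eq_sqrt_sum, Finset.sum_comm]
  simp [Matrix.trace, Matrix.mul_apply, Complex.normSq_apply, Complex.sq_norm]

theorem norm_trace_mul_le (A B : Matrix n n ℂ) : ‖(A * B).trace‖ ≤ ‖A‖ * ‖B‖ := by
  calc ‖(A * B).trace‖ ≤ ∑ p : n × n, ‖A p.1 p.2‖ * ‖B p.2 p.1‖ := by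
        rw [Matrix.trace, Fintype.sum_prod_type]
        refine norm_sum_le_of_le _ fun i _ => ?_
        rw [Matrix.diag_apply, Matrix.mul_apply]
        exact norm_sum_le_of_le _ fun j _ => norm_mul_le _ _
    _ ≤ √(∑ p : n × n, ‖A p.1 p.2‖ ^ 2) * √(∑ p : n × n, ‖B p.2 p.1‖ ^ 2) :=
        Real.sum_mul_le_sqrt_mul_sqrt _ _ _
    _ = ‖A‖ * ‖B‖ := by
        rw [Fintype.sum_prod_type, Fintype.sum_prod_type_right, frobenius_norm_eq_sqrt_sum,
          frobenius_norm_eq_sqrt_sum]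

theorem frobeniusNorm_eq_norm {N : ℕ} (A : Matrix (Fin N) (Fin N) ℂ) : frobeniusNorm A = ‖A‖ :=
  (frobenius_norm_eq_sqrt_trace A).symm

theorem frobenius_norm_unitary_mul [DecidableEq n] (u : Matrix.unitaryGroup n ℂ)
    (A : Matrix n n ℂ) : ‖(u : Matrix n n ℂ) * A‖ = ‖A‖ := by
  have hu : (u : Matrix n n ℂ)ᴴ * u = 1 := u.2.1
  rw [frobenius_norm_eq_sqrt_trace, frobenius_norm_eq_sqrt_trace, Matrix.conjTranspose_mul,
    Matrix.mul_assoc, ← Matrix.mul_assoc _ (u : Matrix n n ℂ) A, hu, Matrix.one_mul]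

theorem frobenius_norm_mul_unitary [DecidableEq n] (A : Matrix n n ℂ)
    (u : Matrix.unitaryGroup n ℂ) : ‖A * (u : Matrix n n ℂ)‖ = ‖A‖ := by
  rw [← Matrix.frobenius_norm_conjTranspose, Matrix.conjTranspose_mul]
  exact (frobenius_norm_unitary_mul u⁻¹ Aᴴ).trans (Matrix.frobenius_norm_conjTranspose A)

instance [DecidableEq n] : IsIsometricSMul (Matrix.unitaryGroup n ℂ) (Matrix.unitaryGroup n ℂ) where
  isometry_smul u := Isometry.of_dist_eq fun v w => by
    rw [Subtype.dist_eq, Subtype.dist_eq, dist_eq_norm, dist_eq_norm, smul_eq_mul, smul_eq_mul,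
      Submonoid.coe_mul, Submonoid.coe_mul, ← mul_sub, frobenius_norm_unitary_mul]

instance [DecidableEq n] :
    IsIsometricSMul (Matrix.unitaryGroup n ℂ)ᵐᵒᵖ (Matrix.unitaryGroup n ℂ) where
  isometry_smul u := Isometry.of_dist_eq fun v w => by
    rw [Subtype.dist_eq, Subtype.dist_eq, dist_eq_norm, dist_eq_norm, MulOpposite.smul_eq_mul_unop,
      MulOpposite.smul_eq_mul_unop, Submonoid.coe_mul, Submonoid.coe_mul, ← sub_mul,
      frobenius_norm_mul_unitary]

theorem frobeniusNorm_sub_eq_dist {N : ℕ} (u v : Matrix.unitaryGroup (Fin N) ℂ) :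
    frobeniusNorm ((u : Matrix (Fin N) (Fin N) ℂ) - (v : Matrix (Fin N) (Fin N) ℂ)) = dist u v := by
  rw [frobeniusNorm_eq_norm, Subtype.dist_eq, dist_eq_norm]

theorem FrobeniusStable.exists_lift {Γ : Type*} [Group Γ] (hΓ : FrobeniusStable Γ) {N : ℕ → ℕ}
    (hN : ∀ n, 0 < N n)
    (ψ : Γ →* (∀ n, Matrix.unitaryGroup (Fin (N n)) ℂ) ⧸
      nullFamilies (fun n => Matrix.unitaryGroup (Fin (N n)) ℂ) atTop) :
    ∃ π : Γ →* ∀ n, Matrix.unitaryGroup (Fin (N n)) ℂ, (QuotientGroup.mk' _).comp π = ψ := by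
  set q := QuotientGroup.mk' (nullFamilies (fun n => Matrix.unitaryGroup (Fin (N n)) ℂ) atTop)
  choose ρ hρ using fun x => QuotientGroup.mk'_surjective _ (ψ x)
  obtain ⟨π, hπ⟩ := hΓ N hN (fun n x => ρ x n) fun x y => by
    have hmul : q (ρ x * ρ y) = q (ρ (x * y)) := by rw [map_mul, hρ, hρ, hρ, map_mul]
    exact (mk_eq_mk_iff_tendsto_dist.mp hmul).congr fun n =>
      (frobeniusNorm_sub_eq_dist (ρ (x * y) n) (ρ x n * ρ y n)).symm
  refine ⟨MonoidHom.pi π, MonoidHom.ext fun x => ?_⟩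
  rw [← hρ x]
  exact (mk_eq_mk_iff_tendsto_dist.mpr
    ((hπ x).congr fun n => frobeniusNorm_sub_eq_dist _ _)).symm

end FrobeniusMetric

section ExtensionByInt

variable {K Q : Type*} [Group K] [Group Q] {φ : MulAut K} {D : K →* Q} {T : Q}

theorem map_zpow_apply_eq_conj (hD : ∀ k, D (φ k) = T * D k * T⁻¹) (a : ℤ) (k : K) :
    D ((φ ^ a) k) = T ^ a * D k * (T ^ a)⁻¹ := by
  have map_pow_apply (m : ℕ) (k : K) : D ((φ ^ m) k) = T ^ m * D k * (T ^ m)⁻¹ := by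
    induction m with
    | zero => simp
    | succ m ih => rw [pow_succ', MulAut.mul_apply, hD, ih]; group
  obtain ⟨m, rfl | rfl⟩ := a.eq_nat_or_neg
  · exact_mod_cast map_pow_apply m k
  · have h := map_pow_apply m ((φ ^ m)⁻¹ k)
    rw [MulAut.apply_inv_self] at h
    rw [zpow_neg, zpow_neg, zpow_natCast, zpow_natCast, h]
    group

theorem exists_extend_ker_of_conj {Γ : Type*} [Group Γ] {τ : Γ →* Multiplicative ℤ} {t : Γ}
    (ht : τ t = Multiplicative.ofAdd 1) {D : τ.ker →* Q}
    (hD : ∀ k, D (MulAut.conjNormal t k) = T * D k * T⁻¹) :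
    ∃ ψ : Γ →* Q, ψ.comp τ.ker.subtype = D ∧ ψ t = T := by
  refine ⟨MonoidHom.mk' (fun x => D (kerPart ht x) * T ^ (τ x).toAdd) fun x y => ?_,
    MonoidHom.ext fun k => ?_, ?_⟩
  · rw [kerPart_mul, map_mul, map_zpow_apply_eq_conj hD, map_mul, toAdd_mul]
    group
  · simp [kerPart_coe, MonoidHom.mem_ker.mp k.2]
  · simp [kerPart_self, ht]

end ExtensionByInt

section Comparison

variable {G K B : Type*} [Group G] [Group K] [CommGroup B] {𝒩 : Subgroup G} [𝒩.Normal]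
  {L : 𝒩 →* B} {A D : K →* G}

/-- Two homomorphisms that agree modulo a normal subgroup `𝒩` differ by a homomorphism
`k ↦ L ((A k)⁻¹ * D k)`, for every conjugation-invariant homomorphism `L` from `𝒩` to a commutative
group. -/
def comparisonHom (hL : ∀ g x, L (MulAut.conjNormal g x) = L x)
    (hAD : ∀ k, (A k)⁻¹ * D k ∈ 𝒩) : K →* B :=
  MonoidHom.mk' (fun k => L ⟨(A k)⁻¹ * D k, hAD k⟩) fun k l => by
    rw [← hL (D l)⁻¹ ⟨(A k)⁻¹ * D k, hAD k⟩, mul_comm, ← map_mul]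
    congr 1
    apply Subtype.ext
    simp only [Subgroup.coe_mul, MulAut.conjNormal_apply, map_mul]
    group

theorem comparisonHom_mul_eq {φ : MulAut K} {S T : G} {z : K → 𝒩}
    (hL : ∀ g x, L (MulAut.conjNormal g x) = L x) (hAD : ∀ k, (A k)⁻¹ * D k ∈ 𝒩)
    (hST : S⁻¹ * T ∈ 𝒩) (hA : ∀ k, S * A k * S⁻¹ = A (φ k))
    (hD : ∀ k, T * D k * T⁻¹ = D (φ k) * z k) (k : K) :
    comparisonHom hL hAD (φ k) * L (z k) = comparisonHom hL hAD k := by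
  set Q : 𝒩 := ⟨S⁻¹ * T, hST⟩
  set C : 𝒩 := ⟨(A k)⁻¹ * D k, hAD k⟩
  change L ⟨(A (φ k))⁻¹ * D (φ k), hAD (φ k)⟩ * L (z k) = L C
  have key : (⟨(A (φ k))⁻¹ * D (φ k), hAD (φ k)⟩ * z k : 𝒩) =
      MulAut.conjNormal S (MulAut.conjNormal (A k)⁻¹ Q * C * Q⁻¹) := by
    apply Subtype.ext
    simp only [Subgroup.coe_mul, MulAut.conjNormal_apply, Subgroup.coe_inv, Q, C]
    rw [mul_assoc, ← hD, ← hA]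
    group
  rw [← map_mul, key, hL, map_mul, map_mul, hL, map_inv, mul_inv_cancel_comm]

theorem isOfFinOrder_map_of_isOfFinOrder_displacement {φ : MulAut K} {S T : G} {z : K → 𝒩}
    (hL : ∀ g x, L (MulAut.conjNormal g x) = L x) (hAD : ∀ k, (A k)⁻¹ * D k ∈ 𝒩)
    (hST : S⁻¹ * T ∈ 𝒩) (hA : ∀ k, S * A k * S⁻¹ = A (φ k))
    (hD : ∀ k, T * D k * T⁻¹ = D (φ k) * z k) {k : K}
    (hk : IsOfFinOrder (Abelianization.of (displacement φ k))) : IsOfFinOrder (L (z k)) := by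
  have h := (Abelianization.lift (comparisonHom hL hAD)).isOfFinOrder hk
  rw [Abelianization.lift_apply_of, displacement, map_mul, map_inv,
    ← comparisonHom_mul_eq hL hAD hST hA hD k] at h
  simpa using h

end Comparison

section UnitaryDiagonalization

open scoped Matrix

variable {n : Type*} [Fintype n] [DecidableEq n]

/-- The unitary diagonal matrix with given entries of modulus one. -/
noncomputable def diagonalUnitary : (n → Circle) →* Matrix.unitaryGroup n ℂ where
  toFun w := ⟨Matrix.diagonal fun i => (w i : ℂ), by
    rw [Matrix.mem_unitaryGroup_iff, Matrix.star_eq_conjTranspose, Matrix.diagonal_conjTranspose,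
      Matrix.diagonal_mul_diagonal, ← Matrix.diagonal_one]
    congr 1 with i
    simp [Complex.mul_conj]⟩
  map_one' := Subtype.ext (by simp)
  map_mul' w z := Subtype.ext (by simp)

theorem coe_diagonalUnitary (w : n → Circle) :
    (diagonalUnitary w : Matrix n n ℂ) = Matrix.diagonal fun i => (w i : ℂ) := rfl

open scoped Matrix.Norms.L2Operator in
theorem l2_opNorm_le_sqrt_sum_sq (A : Matrix n n ℂ) : ‖A‖ ≤ √(∑ i, ∑ j, ‖A i j‖ ^ 2) := by
  rw [Matrix.l2_opNorm_def]
  refine ContinuousLinearMap.opNorm_le_bound _ (Real.sqrt_nonneg _) fun v => ?_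
  change ‖WithLp.toLp 2 (A *ᵥ v.ofLp)‖ ≤ _ * ‖WithLp.toLp 2 v.ofLp‖
  rw [← frobenius_norm_eq_sqrt_sum, ← Matrix.frobenius_norm_replicateCol (ι := Unit),
    ← Matrix.frobenius_norm_replicateCol (ι := Unit), Matrix.replicateCol_mulVec]
  exact Matrix.frobenius_norm_mul _ _

open scoped Matrix.Norms.L2Operator in
theorem exists_eq_conj_diagonalUnitary_of_l2_opNorm_sub_one_lt {u : Matrix.unitaryGroup n ℂ}
    (hu : ‖(u : Matrix n n ℂ) - 1‖ < 2) : ∃ (V : Matrix.unitaryGroup n ℂ) (w : n → Circle),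
      u = V * diagonalUnitary w * V⁻¹ := by
  set H := Unitary.argSelfAdjoint u with hHu
  have hH : (H : Matrix n n ℂ).IsHermitian := H.2
  set V := hH.eigenvectorUnitary
  refine ⟨V, fun i => Circle.exp (hH.eigenvalues i), Subtype.ext ?_⟩
  have hHV : Complex.I • (H : Matrix n n ℂ) = (Unitary.toUnits V).val *
      Matrix.diagonal (fun i => Complex.I * hH.eigenvalues i) * (Unitary.toUnits V)⁻¹.val := by
    conv_lhs => rw [hH.spectral_theorem]
    rw [Unitary.conjStarAlgAut_apply, ← Matrix.smul_mul, ← Matrix.mul_smul, ← Matrix.diagonal_smul]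
    rfl
  rw [← expUnitary_argSelfAdjoint hu, selfAdjoint.expUnitary_coe, ← hHu, hHV,
    Matrix.exp_units_conj, Matrix.exp_diagonal]
  congr 3 with i
  rw [Pi.coe_exp, ← Complex.exp_eq_exp_ℂ, Circle.coe_exp, mul_comm]

open scoped Matrix.Norms.Frobenius in
theorem exists_eq_conj_diagonalUnitary_of_dist_one_lt {u : Matrix.unitaryGroup n ℂ}
    (hu : dist u 1 < 2) : ∃ (V : Matrix.unitaryGroup n ℂ) (w : n → Circle),
      u = V * diagonalUnitary w * V⁻¹ := by
  rw [Subtype.dist_eq, dist_eq_norm, frobenius_norm_eq_sqrt_sum] at hu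
  exact exists_eq_conj_diagonalUnitary_of_l2_opNorm_sub_one_lt
    ((l2_opNorm_le_sqrt_sum_sq _).trans_lt hu)

end UnitaryDiagonalization

section LogDet

open scoped Matrix.Norms.Frobenius

variable {n : Type*} [Fintype n] [DecidableEq n]

/-- The branch of `log (det M)` given by the sum of the principal logarithms of the eigenvalues. -/
noncomputable def logDet (M : Matrix n n ℂ) : ℂ := (M.charpoly.roots.map Complex.log).sum

theorem exp_logDet {M : Matrix n n ℂ} (hM : M.det ≠ 0) : Complex.exp (logDet M) = M.det := by
  rw [Matrix.det_eq_prod_roots_charpoly] at hM ⊢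
  rw [logDet, Complex.exp_multiset_sum, Multiset.map_map]
  refine congrArg Multiset.prod ((Multiset.map_congr rfl fun z hz => ?_).trans (Multiset.map_id _))
  exact Complex.exp_log fun hz0 => hM (Multiset.prod_eq_zero (hz0 ▸ hz))

theorem exp_logDet_unitary (u : Matrix.unitaryGroup n ℂ) : Complex.exp (logDet u.val) = u.val.det :=
  exp_logDet ((Matrix.isUnit_iff_isUnit_det u.val).mp (Unitary.toUnits u).isUnit).ne_zero

theorem logDet_unitary_conj (V u : Matrix.unitaryGroup n ℂ) :
    logDet (V * u * V⁻¹ : Matrix.unitaryGroup n ℂ).val = logDet u.val := by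
  have h := Matrix.charpoly_units_conj (Unitary.toUnits V) u.val
  rw [← Matrix.coe_units_inv] at h
  exact congrArg (fun P => (P.roots.map Complex.log).sum) h

theorem logDet_diagonal (w : n → ℂ) : logDet (Matrix.diagonal w) = ∑ i, Complex.log (w i) := by
  rw [logDet, Matrix.charpoly_diagonal, Polynomial.roots_prod _ _ (by
    simp [Finset.prod_ne_zero_iff, Polynomial.X_sub_C_ne_zero])]
  simp

theorem dist_diagonalUnitary_one_sq (w : n → Circle) :
    dist (diagonalUnitary w) 1 ^ 2 = ∑ i, ‖(w i : ℂ) - 1‖ ^ 2 := by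
  have hsub : (diagonalUnitary w : Matrix n n ℂ) - 1 = Matrix.diagonal fun i => (w i : ℂ) - 1 := by
    rw [coe_diagonalUnitary, ← Matrix.diagonal_one]
    exact Matrix.diagonal_sub _ _
  rw [Subtype.dist_eq, dist_eq_norm, OneMemClass.coe_one, hsub, Matrix.frobenius_norm_diagonal,
    EuclideanSpace.norm_sq_eq]

theorem norm_log_sub_sub_one_le {z : ℂ} (hz : ‖z - 1‖ ≤ 1 / 2) :
    ‖Complex.log z - (z - 1)‖ ≤ ‖z - 1‖ ^ 2 := by
  have h := Complex.norm_log_one_add_sub_self_le (hz.trans_lt one_half_lt_one)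
  rw [add_sub_cancel] at h
  have h2 : (1 - ‖z - 1‖)⁻¹ ≤ 2 := inv_le_of_inv_le₀ two_pos (by linarith)
  nlinarith [sq_nonneg ‖z - 1‖]

theorem norm_logDet_sub_trace_le {u : Matrix.unitaryGroup n ℂ} (hu : dist u 1 ≤ 1 / 2) :
    ‖logDet u.val - (u.val - 1).trace‖ ≤ dist u 1 ^ 2 := by
  obtain ⟨V, w, rfl⟩ := exists_eq_conj_diagonalUnitary_of_dist_one_lt (hu.trans_lt (by norm_num))
  have htr : (V * diagonalUnitary w * V⁻¹ : Matrix.unitaryGroup n ℂ).val.trace =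
      ∑ i, (w i : ℂ) := by
    rw [Submonoid.coe_mul, Matrix.trace_mul_comm, ← Submonoid.coe_mul, inv_mul_cancel_left,
      coe_diagonalUnitary, Matrix.trace_diagonal]
  have hdist : dist (V * diagonalUnitary w * V⁻¹) 1 = dist (diagonalUnitary w) 1 := by
    rw [← dist_mul_right _ 1 V, inv_mul_cancel_right, one_mul, ← dist_mul_left V _ 1, mul_one]
  have hlt (i : n) : ‖(w i : ℂ) - 1‖ ≤ 1 / 2 := by
    refine le_trans (abs_le_of_sq_le_sq' ?_ dist_nonneg).2 (hdist ▸ hu)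
    rw [dist_diagonalUnitary_one_sq]
    exact Finset.single_le_sum (f := fun i => ‖(w i : ℂ) - 1‖ ^ 2) (fun _ _ => sq_nonneg _)
      (Finset.mem_univ i)
  rw [logDet_unitary_conj, coe_diagonalUnitary, logDet_diagonal, Matrix.trace_sub, htr,
    Matrix.trace_one, hdist, dist_diagonalUnitary_one_sq]
  calc ‖∑ i, Complex.log (w i) - (∑ i, (w i : ℂ) - Fintype.card n)‖
      = ‖∑ i, (Complex.log (w i) - ((w i : ℂ) - 1))‖ := by simp [Finset.sum_sub_distrib]
    _ ≤ ∑ i, ‖(w i : ℂ) - 1‖ ^ 2 := norm_sum_le_of_le _ fun i _ => norm_log_sub_sub_one_le (hlt i)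

theorem eq_of_exp_eq_of_norm_sub_lt {x y : ℂ} (h : Complex.exp x = Complex.exp y)
    (hxy : ‖x - y‖ < 2 * Real.pi) : x = y := by
  obtain ⟨m, rfl⟩ := Complex.exp_eq_exp_iff_exists_int.mp h
  have hm : ‖(m : ℂ)‖ < 1 := by
    rw [add_sub_cancel_left, norm_mul, mul_assoc, ← mul_lt_iff_lt_one_left Real.two_pi_pos] at *
    simpa [abs_of_pos Real.pi_pos] using hxy
  have hm0 : m = 0 := Int.abs_lt_one_iff.mp (by rw [Complex.norm_intCast] at hm; exact_mod_cast hm)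
  simp [hm0]

theorem logDet_mul {u v : Matrix.unitaryGroup n ℂ} (hu : dist u 1 ≤ 1 / 4) (hv : dist v 1 ≤ 1 / 4) :
    logDet (u * v : Matrix.unitaryGroup n ℂ).val = logDet u.val + logDet v.val := by
  refine eq_of_exp_eq_of_norm_sub_lt ?_ ?_
  · rw [Complex.exp_add, exp_logDet_unitary, exp_logDet_unitary, exp_logDet_unitary,
      Submonoid.coe_mul, Matrix.det_mul]
  set a := (u.val - 1).trace
  set b := (v.val - 1).trace
  set c := ((u.val - 1) * (v.val - 1)).trace
  have htr : ((u * v : Matrix.unitaryGroup n ℂ).val - 1).trace = a + b + c := by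
    rw [← Matrix.trace_add, ← Matrix.trace_add, Submonoid.coe_mul]
    congr 1
    noncomm_ring
  have hc : ‖c‖ ≤ dist u 1 * dist v 1 := by
    rw [Subtype.dist_eq, Subtype.dist_eq, dist_eq_norm, dist_eq_norm]
    exact norm_trace_mul_le _ _
  have huv := dist_mul_one_le u v
  have hLu := norm_logDet_sub_trace_le (u := u) (by linarith)
  have hLv := norm_logDet_sub_trace_le (u := v) (by linarith)
  have hLuv := norm_logDet_sub_trace_le (u := u * v) (by linarith)
  rw [htr] at hLuv
  calc ‖logDet (u * v : Matrix.unitaryGroup n ℂ).val - (logDet u.val + logDet v.val)‖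
      = ‖(logDet (u * v : Matrix.unitaryGroup n ℂ).val - (a + b + c)) + c -
          (logDet u.val - a) - (logDet v.val - b)‖ := by congr 1; ring
    _ ≤ dist (u * v) 1 ^ 2 + dist u 1 * dist v 1 + dist u 1 ^ 2 + dist v 1 ^ 2 :=
        norm_sub_le_of_le (norm_sub_le_of_le (norm_add_le_of_le hLuv hc) hLu) hLv
    _ ≤ 1 := by
        have := dist_nonneg (x := u) (y := 1)
        have := dist_nonneg (x := v) (y := 1)
        have := dist_nonneg (x := u * v) (y := 1)
        nlinarith
    _ < 2 * Real.pi := by linarith [Real.pi_gt_three]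

end LogDet

section LogDetGerm

open scoped Matrix.Norms.Frobenius

variable {ι : Type*} {n : ι → Type*} [∀ i, Fintype (n i)] [∀ i, DecidableEq (n i)]

variable (n) in
/-- The germ along `l` of `log (det (X i))`, for a family of unitary matrices `X i` tending to the
identity. -/
noncomputable def logDetGerm (l : Filter ι) :
    nullFamilies (fun i => Matrix.unitaryGroup (n i) ℂ) l →* Multiplicative (l.Germ ℂ) :=
  MonoidHom.mk' (fun X => .ofAdd (fun i => logDet (X.1 i).val : l.Germ ℂ)) fun X Y => by
    have hX := X.2.eventually_le_const (show (0 : ℝ) < 1 / 4 by norm_num)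
    have hY := Y.2.eventually_le_const (show (0 : ℝ) < 1 / 4 by norm_num)
    refine congrArg Multiplicative.ofAdd (Germ.coe_eq.mpr ?_)
    filter_upwards [hX, hY] with i hXi hYi
    exact logDet_mul hXi hYi

theorem logDetGerm_conjNormal (l : Filter ι) (V : ∀ i, Matrix.unitaryGroup (n i) ℂ)
    (X : nullFamilies (fun i => Matrix.unitaryGroup (n i) ℂ) l) :
    logDetGerm n l (MulAut.conjNormal V X) = logDetGerm n l X :=
  congrArg Multiplicative.ofAdd (Germ.coe_eq.mpr (.of_forall fun _ => logDet_unitary_conj _ _))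

end LogDetGerm

section RootScalar

/-- The point `e ^ (2 π i / N)` of the unit circle. -/
noncomputable def unitRoot (N : ℕ) : Circle := Circle.exp (2 * Real.pi / N)

theorem unitRoot_zpow (N : ℕ) (c : ℤ) : unitRoot N ^ c = Circle.exp (2 * Real.pi * c / N) := by
  rw [unitRoot, ← Circle.exp_zsmul, zsmul_eq_mul, mul_div_assoc', mul_comm]

theorem unitRoot_zpow_eq_one_of_dvd {N : ℕ} (hN : N ≠ 0) {c : ℤ} (hc : (N : ℤ) ∣ c) :
    unitRoot N ^ c = 1 := by
  obtain ⟨b, rfl⟩ := hc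
  rw [zpow_mul, zpow_natCast, unitRoot, ← Circle.exp_nsmul, nsmul_eq_mul,
    mul_div_cancel₀ _ (Nat.cast_ne_zero.mpr hN), Circle.exp_two_pi, one_zpow]

theorem norm_unitRoot_zpow_sub_one_le (N : ℕ) (c : ℤ) :
    ‖((unitRoot N ^ c : Circle) : ℂ) - 1‖ ≤ 2 * Real.pi * |(c : ℝ)| / N := by
  rw [unitRoot_zpow, Circle.coe_exp, mul_comm]
  refine (Real.norm_exp_I_mul_ofReal_sub_one_le).trans_eq ?_
  rw [Real.norm_eq_abs, abs_div, abs_mul, abs_of_pos Real.two_pi_pos, Nat.abs_cast]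

theorem log_unitRoot_zpow {N : ℕ} {c : ℤ} (hc : 2 * |(c : ℝ)| < N) :
    Complex.log ((unitRoot N ^ c : Circle) : ℂ) = 2 * Real.pi * c / N * Complex.I := by
  have hN : (0 : ℝ) < N := hc.trans_le' (by positivity)
  obtain ⟨h1, h2⟩ : -Real.pi < 2 * Real.pi * c / N ∧ 2 * Real.pi * c / N < Real.pi := by
    rw [← abs_lt, abs_div, abs_mul, abs_of_pos Real.two_pi_pos, Nat.abs_cast, div_lt_iff₀ hN]
    nlinarith [Real.pi_pos]
  rw [unitRoot_zpow, Circle.coe_exp, Complex.log_exp] <;> simp_all [le_of_lt]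

/-- The scalar unitary matrix `e ^ (2 π i c / N)` of size `N`. -/
noncomputable def rootScalar (N : ℕ) (c : ℤ) : Matrix.unitaryGroup (Fin N) ℂ :=
  diagonalUnitary fun _ => unitRoot N ^ c

theorem logDet_rootScalar {N : ℕ} {c : ℤ} (hc : 2 * |(c : ℝ)| < N) :
    logDet (rootScalar N c).val = 2 * Real.pi * c * Complex.I := by
  have hN : (0 : ℝ) < N := hc.trans_le' (by positivity)
  have hN' : (N : ℂ) ≠ 0 := by exact_mod_cast hN.ne'
  rw [rootScalar, coe_diagonalUnitary, logDet_diagonal, log_unitRoot_zpow hc]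
  simp only [Finset.sum_const, Finset.card_univ, Fintype.card_fin, nsmul_eq_mul]
  field_simp

open scoped Matrix.Norms.Frobenius

theorem dist_rootScalar_one_sq_le (N : ℕ) (c : ℤ) :
    dist (rootScalar N c) 1 ^ 2 ≤ (2 * Real.pi * |(c : ℝ)|) ^ 2 / N := by
  rw [rootScalar, dist_diagonalUnitary_one_sq]
  calc ∑ _ : Fin N, ‖((unitRoot N ^ c : Circle) : ℂ) - 1‖ ^ 2
      ≤ ∑ _ : Fin N, (2 * Real.pi * |(c : ℝ)| / N) ^ 2 := by
        gcongr; exact norm_unitRoot_zpow_sub_one_le N c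
    _ = (2 * Real.pi * |(c : ℝ)|) ^ 2 / N := by
        rw [Finset.sum_const, Finset.card_univ, Fintype.card_fin, nsmul_eq_mul]
        field_simp

variable {ι : Type*} {l : Filter ι} {N : ι → ℕ}

theorem rootScalar_mem_nullFamilies (hN : Tendsto N l atTop) (c : ℤ) :
    (fun i => rootScalar (N i) c) ∈
      nullFamilies (fun i => Matrix.unitaryGroup (Fin (N i)) ℂ) l := by
  have h : Tendsto (fun i => dist (rootScalar (N i) c) 1 ^ 2) l (𝓝 0) :=
    squeeze_zero (fun _ => sq_nonneg _) (fun i => dist_rootScalar_one_sq_le (N i) c)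
      (tendsto_const_nhds.div_atTop (tendsto_natCast_atTop_atTop.comp hN))
  have h2 := h.sqrt
  simp only [Real.sqrt_sq dist_nonneg, Real.sqrt_zero] at h2
  exact h2

theorem logDetGerm_rootScalar (hN : Tendsto N l atTop) (c : ℤ) :
    logDetGerm (fun i => Fin (N i)) l
        ⟨fun i => rootScalar (N i) c, rootScalar_mem_nullFamilies hN c⟩ =
      Multiplicative.ofAdd ((2 * Real.pi * c * Complex.I : ℂ) : l.Germ ℂ) := by
  refine congrArg Multiplicative.ofAdd (Germ.coe_eq.mpr ?_)
  filter_upwards [(tendsto_natCast_atTop_atTop.comp hN).eventually_gt_atTop (2 * |(c : ℝ)|)]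
    with i hi
  exact logDet_rootScalar hi

theorem eq_zero_of_isOfFinOrder_logDetGerm_rootScalar [l.NeBot] (hN : Tendsto N l atTop) {c : ℤ}
    (hc : IsOfFinOrder (logDetGerm (fun i => Fin (N i)) l
      ⟨fun i => rootScalar (N i) c, rootScalar_mem_nullFamilies hN c⟩)) : c = 0 := by
  rw [logDetGerm_rootScalar hN] at hc
  obtain ⟨m, hm, h⟩ := hc.exists_pow_eq_one
  have h' : ((m • (2 * Real.pi * c * Complex.I) : ℂ) : l.Germ ℂ) = ((0 : ℂ) : l.Germ ℂ) := h
  simpa [hm.ne', Real.pi_ne_zero] using Germ.const_inj.mp h'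

end RootScalar

section OrbitRepresentation

variable {n : Type*} [Fintype n] [DecidableEq n]

/-- The permutation matrix of `σ` as a unitary matrix. -/
noncomputable def permUnitary (σ : Equiv.Perm n) : Matrix.unitaryGroup n ℂ :=
  ⟨σ.permMatrix ℂ, by
    rw [Matrix.mem_unitaryGroup_iff, Matrix.star_eq_conjTranspose, Matrix.conjTranspose_permMatrix,
      ← Matrix.permMatrix_mul, inv_mul_cancel, Matrix.permMatrix_one]⟩

theorem permUnitary_conj_diagonalUnitary (σ : Equiv.Perm n) (w : n → Circle) :
    permUnitary σ * diagonalUnitary w * (permUnitary σ)⁻¹ = diagonalUnitary (w ∘ σ) := by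
  refine mul_inv_eq_of_eq_mul (Subtype.ext (Matrix.ext fun i j => ?_))
  change (σ.permMatrix ℂ * Matrix.diagonal fun i => (w i : ℂ)) i j =
    ((Matrix.diagonal fun i => (w (σ i) : ℂ)) * σ.permMatrix ℂ) i j
  rw [Matrix.mul_diagonal, Matrix.diagonal_mul, Equiv.Perm.permMatrix, PEquiv.toMatrix_apply]
  by_cases hij : σ i = j <;> simp [hij]

variable {K : Type*} [Group K]

/-- The diagonal representation of `K` on `ℂ ^ N` whose `i`-th entry is the character
`e ^ (2 π i h / N)`, for `h` the sum of `χ` along the first `i` points of the orbit under `φ`. -/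
noncomputable def orbitRep (φ : MulAut K) (χ : K →* Multiplicative ℤ) (N : ℕ) :
    K →* Matrix.unitaryGroup (Fin N) ℂ :=
  diagonalUnitary.comp
    (MonoidHom.pi fun i => (zpowersHom Circle (unitRoot N)).comp (orbitSum φ χ i))

theorem finRotate_conj_orbitRep {φ : MulAut K} {χ : K →* Multiplicative ℤ} {N : ℕ}
    (hN : ∀ k, (N : ℤ) ∣ (orbitSum φ χ N k).toAdd) (k : K) :
    permUnitary (finRotate N) * orbitRep φ χ N k * (permUnitary (finRotate N))⁻¹ =
      orbitRep φ χ N (φ k) * rootScalar N (χ k).toAdd := by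
  rw [orbitRep, MonoidHom.comp_apply, MonoidHom.comp_apply, permUnitary_conj_diagonalUnitary,
    rootScalar, ← map_mul]
  congr 1 with i
  have hi : unitRoot N ^ (orbitSum φ χ (finRotate N i) k).toAdd =
      unitRoot N ^ (orbitSum φ χ (i + 1) k).toAdd := by
    cases N with
    | zero => exact i.elim0
    | succ m =>
      rcases eq_or_ne i (Fin.last m) with rfl | hi
      · rw [finRotate_last, Fin.val_last, unitRoot_zpow_eq_one_of_dvd m.succ_ne_zero (hN k)]
        simp [orbitSum_zero]
      · rw [coe_finRotate_of_ne_last hi]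
  rw [orbitSum_succ_apply, toAdd_mul, add_comm, zpow_add] at hi
  exact congrArg Subtype.val hi

end OrbitRepresentation

section MainTheorem

variable {Γ : Type*} [Group Γ]

open scoped Matrix.Norms.Frobenius in
theorem not_frobeniusStable_of_character {τ : Γ →* Multiplicative ℤ} {t : Γ}
    (ht : τ t = Multiplicative.ofAdd 1)
    (hφ : IsUnipotent (MulAut.conjNormal t : MulAut τ.ker)) {χ : τ.ker →* Multiplicative ℤ}
    {k : τ.ker} (hχ : χ k ≠ 1)
    (hk : IsOfFinOrder (Abelianization.of (displacement (MulAut.conjNormal t) k))) :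
    ¬ FrobeniusStable Γ := fun hΓ => by
  obtain ⟨d, hd⟩ := hφ.exists_forall_prime_dvd_orbitSum χ
  choose N hN hNprime using fun n : ℕ => Nat.exists_infinite_primes (n + d)
  have hNlim : Tendsto N atTop atTop :=
    tendsto_atTop_mono (fun n => (Nat.le_add_right n d).trans (hN n)) tendsto_id
  set 𝒩 := nullFamilies (fun n => Matrix.unitaryGroup (Fin (N n)) ℂ) atTop
  set D := MonoidHom.pi fun n => orbitRep (MulAut.conjNormal t) χ (N n)
  set T := fun n => permUnitary (finRotate (N n))
  set z : τ.ker → 𝒩 := fun l => ⟨_, rootScalar_mem_nullFamilies hNlim (χ l).toAdd⟩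
  have hD (l : τ.ker) : T * D l * T⁻¹ = D (MulAut.conjNormal t l) * z l := funext fun n =>
    finRotate_conj_orbitRep (hd _ (hNprime n) ((Nat.le_add_left d n).trans (hN n))) l
  have hD' (l : τ.ker) : (QuotientGroup.mk' 𝒩).comp D (MulAut.conjNormal t l) =
      QuotientGroup.mk' 𝒩 T * (QuotientGroup.mk' 𝒩).comp D l * (QuotientGroup.mk' 𝒩 T)⁻¹ := by
    rw [MonoidHom.comp_apply, MonoidHom.comp_apply, ← map_mul, ← map_inv, ← map_mul, hD]
    exact (QuotientGroup.mk_mul_of_mem _ (z l).2).symm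
  obtain ⟨ψ, hψD, hψT⟩ := exists_extend_ker_of_conj ht hD'
  obtain ⟨π, rfl⟩ := hΓ.exists_lift (fun n => (hNprime n).pos) ψ
  have hL := isOfFinOrder_map_of_isOfFinOrder_displacement (L := logDetGerm _ atTop)
    (A := π.comp τ.ker.subtype) (D := D) (logDetGerm_conjNormal atTop)
    (fun l => QuotientGroup.eq.mp (DFunLike.congr_fun hψD l)) (QuotientGroup.eq.mp hψT)
    (fun l => by simp) hD hk
  exact hχ (eq_zero_of_isOfFinOrder_logDetGerm_rootScalar hNlim hL)

theorem mainTheorem1_general [Group.FG Γ] [Group.IsNilpotent Γ]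
    (hΓ : ∀ H : Subgroup Γ, IsCyclic H → ¬ H.FiniteIndex) : ¬ FrobeniusStable Γ := by
  have : Infinite Γ := not_finite_iff_infinite.mp fun _ => hΓ ⊥ inferInstance inferInstance
  obtain ⟨τ, t, ht⟩ := exists_eq_ofAdd_one_of_infinite_of_isNilpotent Γ
  have : Infinite τ.ker := not_finite_iff_infinite.mp fun _ =>
    hΓ (Subgroup.zpowers t) inferInstance (finiteIndex_zpowers_of_finite_ker ht)
  have hφ : IsUnipotent (MulAut.conjNormal t : MulAut τ.ker) := isUnipotent_conjNormal τ.ker t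
  have := fg_ker_of_isUnipotent ht hφ
  obtain ⟨y, hy⟩ := exists_not_isOfFinOrder_abelianization τ.ker
  obtain ⟨k, hk, hφk⟩ := hφ.exists_isOfFinOrder_displacement hy
  obtain ⟨χ, hχ⟩ := exists_ne_one_of_not_isOfFinOrder_abelianization hk
  exact not_frobeniusStable_of_character ht hφ hχ hφk

theorem nonempty_mulEquiv_int_of_finiteIndex_isCyclic [Group.FG Γ] [Group.IsNilpotent Γ]
    [Nontrivial Γ] (htf : ∀ g : Γ, g ≠ 1 → ¬ IsOfFinOrder g) (H : Subgroup Γ) [IsCyclic H]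
    [H.FiniteIndex] : Nonempty (Γ ≃* Multiplicative ℤ) := by
  obtain ⟨g, hg⟩ := exists_ne (1 : Γ)
  have : Infinite Γ := not_finite_iff_infinite.mp fun _ => htf g hg (isOfFinOrder_of_finite g)
  obtain ⟨τ, t, ht⟩ := exists_eq_ofAdd_one_of_infinite_of_isNilpotent Γ
  have hτ : τ ≠ 1 := by
    rintro rfl
    exact one_ne_zero (ofAdd_eq_one.mp ht.symm)
  exact ⟨MulEquiv.ofBijective τ
    ⟨injective_of_finiteIndex_isCyclic htf hτ H, surjective_of_eq_ofAdd_one ht⟩⟩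

end MainTheorem

theorem mainTheorem1 (Γ : Type*) [Group Γ] (hfg : Group.FG Γ) (hnil : Group.IsNilpotent Γ)
    (htf : ∀ g : Γ, g ≠ 1 → ¬ IsOfFinOrder g) (hnontriv : Nontrivial Γ)
    (hZ : ¬ Nonempty (Γ ≃* Multiplicative ℤ)) :
    ¬ FrobeniusStable Γ :=
  mainTheorem1_general fun H _ _ => hZ (nonempty_mulEquiv_int_of_finiteIndex_isCyclic htf H)
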